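/- Let $q$ be a prime power and let $k\ge 0$ be an integer. For each integer $n\ge 1$, an element $\alpha\in\mathbb{F}_{q^n}$ is called $k$-normal over $\mathbb{F}_q$ if $k\le n$ and the $\mathbb{F}_q$-vector space spanned by $\{\alpha,\alpha^q,\ldots,\alpha^{q^{n-1}}\}$ has dimension $n-k$. Let $\lambda_{q,n,k}$ be the number of $\alpha\in\mathbb{F}_{q^n}$ that are $k$-normal over $\mathbb{F}_q$ (so $\lambda_{q,n,k}=0$ if $n<k$), and set $\lambda_{q,k}(n)=\lambda_{q,n,k}/q^n$. Then there exists a real number $\overline{\lambda}_{q,k}\ge 0$ (depending only on $q$ and $k$) such that $$\overline{\lambda}_{q,k}=\lim_{t\to+\infty}\frac{1}{t}\sum_{1\le n\le t}\lambda_{q,k}(n),$$ where $t$ ranges over the real numbers. -/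

import Mathlib

open Filter Topology

/-- Let `K` be an extension of `F` of degree `n`, where `F` has `q` elements. An element `α` of `K`
is `k`-normal over `F` if the `F`-span of `α, α ^ q, …, α ^ (q ^ (n - 1))` has dimension `n - k`
with `0 ≤ k ≤ n`; this is written additively, so that no element is `k`-normal when `n < k`. -/
def IsKNormal (F : Type*) {K : Type*} [Field F] [Field K] [Algebra F K] (k : ℕ) (α : K) : Prop :=
  Module.finrank F (Submodule.span F
      (Set.range fun i : Fin (Module.finrank F K) => α ^ (Nat.card F ^ (i : ℕ)))) + k
    = Module.finrank F K

/-- The number of elements of `K` that are `k`-normal over `F`. -/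
noncomputable def kNormalCount (F K : Type*) [Field F] [Field K] [Algebra F K] (k : ℕ) : ℕ :=
  Nat.card {α : K // IsKNormal F k α}

/-!
Let `F` have `q` elements and characteristic `p`, and let `K` be its extension of degree `n`. With
`X` acting as the Frobenius automorphism, `K` is the cyclic `F[X]`-module `F[X] / (X ^ n - 1)`. The
conjugates of the element with residue `f` span the submodule generated by `f`, whose codimension is
the degree of `gcd (f, X ^ n - 1)`. So the proportion `λ(n)` of `k`-normal elements is the proportion
of polynomials `f` of degree `< n` with `deg gcd (f, X ^ n - 1) = k`
(`kNormalCount_div_eq_gcdDensity`), and it depends only on `q`, `k` and `n`.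

The mean value exists because `λ` is approximated in mean by the periodic functions
`n ↦ λ (gcd (n, N))` (`exists_tendsto_meanUpTo`). To compare `λ(n)` with `λ(m)`, where
`m = gcd (n, N)`, put `C = (X ^ n - 1) / (X ^ m - 1)`. If `f` is coprime to `C`, then `f` has the same
gcd with `X ^ n - 1` as with `X ^ m - 1`. Residues modulo `X ^ m - 1` are equidistributed among the
`f`, so `|λ(n) - λ(m)|` is at most the sum of `q ^ (-deg P)` over the monic irreducible factors `P`
of `C`.

Let `N` be divisible by `p ^ D` and by `q ^ d - 1` for `1 ≤ d ≤ D`. An irreducible factor of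
`X ^ n - 1` of degree `d ≤ D` already divides `X ^ m - 1`, because it divides
`X ^ gcd (n, q ^ d - 1) - 1`. It divides `C` too only if `p ∣ n / m`, since `C ≡ n / m` modulo it,
and then `p ^ (D + 1) ∣ n`. For all other `n` the factors of `C` have degree `> D`. At most
`gcd (n, q ^ d - 1)` of them have degree `d`, and the mean over `n` of this gcd is at most the number
`τ(q ^ d - 1)` of divisors. Hence the mean error is at most
`p ^ (-D - 1) + ∑_{d > D} τ(q ^ d - 1) / q ^ d`. It tends to `0` as `D → ∞`, because
`τ(m) ≤ 2 √m` makes the series converge.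
-/

open Polynomial

/-! ### The Frobenius automorphism and its orbits -/

section Frobenius

variable (F K : Type*) [Field F] [Fintype F] [Field K] [Algebra F K] [Finite K]

/-- `K` is a cyclic `F[X]`-module when `X` acts as the Frobenius automorphism, with annihilator
generated by `X ^ n - 1`. -/
theorem exists_aeval_frobenius_apply_eq_zero_iff :
    ∃ x : K, ∀ p : F[X], aeval (FiniteField.frobeniusAlgHom F K).toLinearMap p x = 0 ↔
      X ^ Module.finrank F K - 1 ∣ p := by
  obtain ⟨x, hx⟩ := Module.exists_ker_toSpanSingleton_eq_annihilator F[X]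
    (Module.AEval' (FiniteField.frobeniusAlgHom F K).toLinearMap)
  obtain ⟨x, rfl⟩ := (Module.AEval'.of _).surjective x
  refine ⟨x, fun p => ?_⟩
  rw [← Polynomial.span_minpoly_eq_annihilator, FiniteField.minpoly_frobeniusAlgHom] at hx
  rw [← Ideal.mem_span_singleton, ← hx, LinearMap.mem_ker, LinearMap.toSpanSingleton_apply,
    ← LinearEquiv.map_eq_zero_iff (Module.AEval'.of (FiniteField.frobeniusAlgHom F K).toLinearMap)]
  rfl

variable {F K}

/-- The linear map `p ↦ p(φ) x`, where `φ` is the Frobenius endomorphism of `K` over `F`. -/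
noncomputable def frobeniusOrbitMap (x : K) : F[X] →ₗ[F] K :=
  LinearMap.applyₗ x ∘ₗ (aeval (FiniteField.frobeniusAlgHom F K).toLinearMap).toLinearMap

omit [Finite K] in
theorem frobeniusOrbitMap_mul (x : K) (p r : F[X]) :
    frobeniusOrbitMap x (r * p) = frobeniusOrbitMap (frobeniusOrbitMap x p) r := by
  simp [frobeniusOrbitMap]

omit [Finite K] in
theorem frobeniusOrbitMap_X_pow (x : K) (i : ℕ) :
    frobeniusOrbitMap (F := F) x (X ^ i) = x ^ Nat.card F ^ i := by
  simp only [frobeniusOrbitMap, LinearMap.comp_apply, AlgHom.toLinearMap_apply, map_pow, aeval_X,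
    LinearMap.applyₗ_apply_apply, Module.End.coe_pow, Nat.card_eq_fintype_card]
  induction i with
  | zero => simp
  | succ i ih =>
    rw [Function.iterate_succ_apply', ih]
    simp [pow_succ, pow_mul]

theorem frobeniusOrbitMap_X_pow_finrank_sub_one (x : K) :
    frobeniusOrbitMap (F := F) x (X ^ Module.finrank F K - 1) = 0 := by
  rw [map_sub, frobeniusOrbitMap_X_pow, ← pow_zero X, frobeniusOrbitMap_X_pow,
    ← Module.natCard_eq_pow_finrank]
  have := Fintype.ofFinite K
  simp [Nat.card_eq_fintype_card, FiniteField.pow_card]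

/-- Exponents below `n` suffice, because `φ ^ n = 1`. -/
theorem range_frobeniusOrbitMap (x : K) :
    LinearMap.range (frobeniusOrbitMap (F := F) x) =
      Submodule.span F (Set.range fun i : Fin (Module.finrank F K) =>
        x ^ (Nat.card F ^ (i : ℕ))) := by
  have hn : Module.finrank F K ≠ 0 := Module.finrank_pos.ne'
  have hm : (X ^ Module.finrank F K - 1 : F[X]).Monic := monic_X_pow_sub_C 1 hn
  apply le_antisymm
  · rintro _ ⟨r, rfl⟩
    have h1 : frobeniusOrbitMap x r =
        frobeniusOrbitMap x (r %ₘ (X ^ Module.finrank F K - 1)) := by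
      conv_lhs => rw [← modByMonic_add_div r (X ^ Module.finrank F K - 1)]
      rw [map_add, mul_comm, frobeniusOrbitMap_mul, frobeniusOrbitMap_X_pow_finrank_sub_one]
      simp [frobeniusOrbitMap]
    have h2 : (r %ₘ (X ^ Module.finrank F K - 1)).natDegree < Module.finrank F K := by
      have := natDegree_modByMonic_lt r hm (fun h => by
        have := congrArg natDegree h
        rw [← C_1, natDegree_X_pow_sub_C, natDegree_C] at this
        exact hn this)
      rwa [← C_1, natDegree_X_pow_sub_C] at this
    rw [h1, as_sum_range' _ _ h2, map_sum]
    refine Submodule.sum_mem _ fun i hi => ?_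
    rw [← smul_X_eq_monomial, map_smul, frobeniusOrbitMap_X_pow]
    exact Submodule.smul_mem _ _ (Submodule.subset_span ⟨⟨i, Finset.mem_range.1 hi⟩, rfl⟩)
  · rw [Submodule.span_le]
    rintro _ ⟨i, rfl⟩
    exact ⟨X ^ (i : ℕ), frobeniusOrbitMap_X_pow x i⟩

end Frobenius

/-! ### The degree of a greatest common divisor -/

open Classical in
/-- The degree of the greatest common divisor of `p` and `A`. -/
noncomputable def gcdDegree {F : Type*} [Field F] (p A : F[X]) : ℕ :=
  (EuclideanDomain.gcd p A).natDegree

theorem gcdDegree_congr {F : Type*} [Field F] {p A p' A' : F[X]}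
    (h : Ideal.span {p, A} = Ideal.span {p', A'}) : gcdDegree p A = gcdDegree p' A' := by
  classical
  unfold gcdDegree
  rw [← EuclideanDomain.span_gcd, ← EuclideanDomain.span_gcd, Ideal.span_singleton_eq_span_singleton]
    at h
  convert natDegree_eq_of_degree_eq (degree_eq_degree_of_associated h)

/-! ### The count of `k`-normal elements in terms of polynomials -/

section Count

variable {F K : Type*} [Field F] [Fintype F] [Field K] [Algebra F K] [Finite K]

theorem surjective_frobeniusOrbitMap {x : K}
    (hx : ∀ p : F[X], frobeniusOrbitMap x p = 0 ↔ X ^ Module.finrank F K - 1 ∣ p) :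
    Function.Surjective (frobeniusOrbitMap (F := F) x) := by
  have hn : Module.finrank F K ≠ 0 := Module.finrank_pos.ne'
  have hk : LinearMap.ker (frobeniusOrbitMap (F := F) x) =
      (Ideal.span {(X ^ Module.finrank F K - 1 : F[X])}).restrictScalars F := by
    ext p
    simp [hx, Ideal.mem_span_singleton]
  rw [← LinearMap.range_eq_top]
  apply Submodule.eq_top_of_finrank_eq
  rw [← (frobeniusOrbitMap (F := F) x).quotKerEquivRange.finrank_eq, hk,
    (Submodule.Quotient.restrictScalarsEquiv F _).finrank_eq, finrank_quotient_span_eq_natDegree,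
    ← C_1, natDegree_X_pow_sub_C]

/-- The span of the conjugates of `p(φ) x` is the image of the ideal generated by `p`, whose preimage
in `F[X]` is generated by `gcd (p, X ^ n - 1)`. -/
theorem finrank_span_conjugates_add_gcdDegree {x : K}
    (hx : ∀ p : F[X], frobeniusOrbitMap x p = 0 ↔ X ^ Module.finrank F K - 1 ∣ p) (p : F[X]) :
    Module.finrank F (Submodule.span F (Set.range fun i : Fin (Module.finrank F K) =>
        frobeniusOrbitMap x p ^ (Nat.card F ^ (i : ℕ)))) +
      gcdDegree p (X ^ Module.finrank F K - 1) = Module.finrank F K := by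
  classical
  rw [← range_frobeniusOrbitMap]
  set W := LinearMap.range (frobeniusOrbitMap (F := F) (frobeniusOrbitMap x p)) with hW
  have hker : LinearMap.ker (W.mkQ ∘ₗ frobeniusOrbitMap (F := F) x) = (Ideal.span
      {EuclideanDomain.gcd p (X ^ Module.finrank F K - 1 : F[X])}).restrictScalars F := by
    ext s
    rw [LinearMap.mem_ker, LinearMap.comp_apply, Submodule.mkQ_apply,
      Submodule.Quotient.mk_eq_zero, Submodule.restrictScalars_mem, EuclideanDomain.span_gcd,
      Ideal.mem_span_pair]
    constructor
    · rintro ⟨r, hr⟩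
      rw [← frobeniusOrbitMap_mul, eq_comm, ← sub_eq_zero, ← map_sub, hx] at hr
      obtain ⟨c, hc⟩ := hr
      exact ⟨r, c, by linear_combination -hc⟩
    · rintro ⟨r, c, rfl⟩
      refine ⟨r, ?_⟩
      rw [map_add, (hx _).2 (dvd_mul_left _ c), add_zero, frobeniusOrbitMap_mul]
  have hsurj : Function.Surjective (W.mkQ ∘ₗ frobeniusOrbitMap (F := F) x) :=
    W.mkQ_surjective.comp (surjective_frobeniusOrbitMap hx)
  have h := (LinearMap.quotKerEquivOfSurjective _ hsurj).finrank_eq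
  rw [hker, (Submodule.Quotient.restrictScalarsEquiv F _).finrank_eq,
    finrank_quotient_span_eq_natDegree] at h
  rw [add_comm, gcdDegree, h, W.finrank_quotient_add_finrank]

variable (F K) in
/-- Choosing a generator of the cyclic `F[X]`-module `K` identifies the elements of `K` with the
polynomials of degree `< n`; the `k`-normal ones correspond to those whose gcd with `X ^ n - 1` has
degree `k`. -/
theorem kNormalCount_eq_card_gcdDegree (k : ℕ) :
    kNormalCount F K k = Nat.card {p : degreeLT F (Module.finrank F K) //
      gcdDegree (p : F[X]) (X ^ Module.finrank F K - 1) = k} := by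
  obtain ⟨x, hx⟩ := exists_aeval_frobenius_apply_eq_zero_iff F K
  change ∀ p : F[X], frobeniusOrbitMap x p = 0 ↔ _ at hx
  have hn : Module.finrank F K ≠ 0 := Module.finrank_pos.ne'
  have hinj : Function.Injective
      ((frobeniusOrbitMap (F := F) x).domRestrict (degreeLT F (Module.finrank F K))) := by
    rw [← LinearMap.ker_eq_bot, LinearMap.ker_eq_bot']
    rintro ⟨p, hp⟩ h0
    have hd := (hx p).1 h0
    ext1
    refine eq_zero_of_dvd_of_degree_lt hd ?_
    rw [← C_1, degree_X_pow_sub_C (Nat.pos_of_ne_zero hn)]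
    exact mem_degreeLT.1 hp
  have hfr : Module.finrank F (degreeLT F (Module.finrank F K)) = Module.finrank F K := by
    rw [(degreeLTEquiv F _).finrank_eq]; simp
  have : FiniteDimensional F (degreeLT F (Module.finrank F K)) :=
    (degreeLTEquiv F (Module.finrank F K)).symm.finiteDimensional
  let e := LinearEquiv.ofInjectiveOfFinrankEq _ hinj hfr
  refine (Nat.card_congr (e.toEquiv.subtypeEquiv fun p => ?_)).symm
  have h := finrank_span_conjugates_add_gcdDegree hx (p : F[X])
  change _ ↔ _ + k = Module.finrank F K
  have he : e.toEquiv p = frobeniusOrbitMap x (p : F[X]) := rfl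
  rw [he]
  omega

end Count

/-! ### Densities of sets of polynomials of bounded degree -/

section Density

variable (F : Type*) [Field F]

/-- The proportion of polynomials of degree `< n` over a finite field that satisfy `T`. -/
noncomputable def polyDensity (n : ℕ) (T : F[X] → Prop) : ℝ :=
  (Nat.card {p : degreeLT F n // T p} : ℝ) / (Nat.card F : ℝ) ^ n

variable [Finite F]

instance finite_degreeLT (n : ℕ) : Finite (degreeLT F n) :=
  Finite.of_equiv _ (degreeLTEquiv F n).symm.toEquiv

omit [Finite F] in
theorem natCard_degreeLT (n : ℕ) : Nat.card (degreeLT F n) = Nat.card F ^ n := by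
  rw [Nat.card_congr (degreeLTEquiv F n).toEquiv, Nat.card_fun, Nat.card_fin]

omit [Finite F] in
theorem polyDensity_nonneg (n : ℕ) (T : F[X] → Prop) : 0 ≤ polyDensity F n T := by
  unfold polyDensity; positivity

theorem polyDensity_le_one (n : ℕ) (T : F[X] → Prop) : polyDensity F n T ≤ 1 := by
  have h : 0 < (Nat.card F : ℝ) := by exact_mod_cast Nat.card_pos
  rw [polyDensity, div_le_one (by positivity), ← Nat.cast_pow, ← natCard_degreeLT]
  exact_mod_cast Finite.card_subtype_le _

theorem polyDensity_mono {n : ℕ} {S T : F[X] → Prop} (h : ∀ p, S p → T p) :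
    polyDensity F n S ≤ polyDensity F n T := by
  unfold polyDensity
  gcongr
  exact Nat.card_le_card_of_injective
    (Subtype.map id fun p hp => h _ hp) (Subtype.map_injective _ Function.injective_id)

omit [Finite F] in
theorem polyDensity_or_le (n : ℕ) (S T : F[X] → Prop) :
    polyDensity F n (fun p => S p ∨ T p) ≤ polyDensity F n S + polyDensity F n T := by
  unfold polyDensity
  rw [← add_div]
  gcongr
  exact_mod_cast (Set.ncard_union_le {p : degreeLT F n | S p} {p : degreeLT F n | T p})

omit [Finite F] in
theorem polyDensity_exists_mem_le {ι : Type*} (n : ℕ) (s : Finset ι) (T : ι → F[X] → Prop) :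
    polyDensity F n (fun p => ∃ i ∈ s, T i p) ≤ ∑ i ∈ s, polyDensity F n (T i) := by
  classical
  induction s using Finset.induction_on with
  | empty => simp [polyDensity]
  | insert a s ha ih =>
    rw [Finset.sum_insert ha]
    simp only [Finset.exists_mem_insert]
    exact (polyDensity_or_le F n _ _).trans (by gcongr)

theorem abs_polyDensity_sub_le {n : ℕ} {S T U : F[X] → Prop}
    (h : ∀ p, ¬ U p → (S p ↔ T p)) :
    |polyDensity F n S - polyDensity F n T| ≤ polyDensity F n U := by
  have h1 : polyDensity F n S ≤ polyDensity F n T + polyDensity F n U :=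
    (polyDensity_mono F fun p hp => by have := h p; tauto).trans (polyDensity_or_le F n T U)
  have h2 : polyDensity F n T ≤ polyDensity F n S + polyDensity F n U :=
    (polyDensity_mono F fun p hp => by have := h p; tauto).trans (polyDensity_or_le F n S U)
  rw [abs_sub_le_iff]
  constructor <;> linarith

/-- Fibres of a surjective homomorphism of finite groups all have the same size. -/
theorem natCard_subtype_comp_mul {G H : Type*} [AddGroup G] [AddGroup H] [Finite G] [Finite H]
    (f : G →+ H) (hf : Function.Surjective f) (T : H → Prop) :
    Nat.card {g // T (f g)} * Nat.card H = Nat.card {h // T h} * Nat.card G := by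
  have hfib : ∀ h : H, Nat.card {g // f g = h} = Nat.card f.ker := fun h => by
    obtain ⟨g₀, rfl⟩ := hf h
    refine Nat.card_congr ((Equiv.subRight g₀).subtypeEquiv fun g => ?_)
    simp [AddMonoidHom.mem_ker, sub_eq_zero]
  have e1 : {g // T (f g)} ≃ Σ h : {h // T h}, {g // f g = h} :=
    (Equiv.sigmaSubtypeFiberEquivSubtype f (fun _ => Iff.rfl)).symm
  have key : Nat.card {g // T (f g)} = Nat.card {h // T h} * Nat.card f.ker := by
    have := Fintype.ofFinite {h // T h}
    rw [Nat.card_congr e1, Nat.card_sigma]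
    simp [hfib]
  have hG : Nat.card G = Nat.card H * Nat.card f.ker := by
    have := Fintype.ofFinite H
    rw [← Nat.card_congr (Equiv.sigmaFiberEquiv f), Nat.card_sigma]
    simp [hfib]
  rw [key, hG]
  ring

/-- Residues modulo a monic polynomial of degree `m ≤ n` are equidistributed among the polynomials
of degree `< n`. -/
theorem polyDensity_modByMonic {B : F[X]} (hB : B.Monic) {n : ℕ} (hn : B.natDegree ≤ n)
    (T : F[X] → Prop) :
    polyDensity F n (fun p => T (p %ₘ B)) = polyDensity F B.natDegree T := by
  have hmem : ∀ p : F[X], p %ₘ B ∈ degreeLT F B.natDegree := fun p => by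
    rw [mem_degreeLT, ← degree_eq_natDegree hB.ne_zero]
    exact degree_modByMonic_lt p hB
  let f : degreeLT F n →ₗ[F] degreeLT F B.natDegree :=
    ((modByMonicHom B).domRestrict (degreeLT F n)).codRestrict _ fun p => hmem p
  have hf : Function.Surjective f := by
    rintro ⟨p, hp⟩
    refine ⟨⟨p, degreeLT_mono hn hp⟩, Subtype.ext ?_⟩
    change p %ₘ B = p
    rw [modByMonic_eq_self_iff hB, degree_eq_natDegree hB.ne_zero]
    exact mem_degreeLT.1 hp
  have h := natCard_subtype_comp_mul f.toAddMonoidHom hf fun p => T p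
  rw [natCard_degreeLT, natCard_degreeLT] at h
  have hq : (Nat.card F : ℝ) ≠ 0 := by exact_mod_cast Nat.card_pos.ne'
  unfold polyDensity
  rw [div_eq_div_iff (by positivity) (by positivity)]
  exact_mod_cast h

theorem polyDensity_dvd {P : F[X]} (hP : P.Monic) {n : ℕ} (hn : P.natDegree ≤ n) :
    polyDensity F n (fun p => P ∣ p) = ((Nat.card F : ℝ) ^ P.natDegree)⁻¹ := by
  simp_rw [← modByMonic_eq_zero_iff_dvd hP]
  rw [polyDensity_modByMonic F hP hn (fun p => p = 0), polyDensity, div_eq_mul_inv]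
  convert one_mul _
  rw [Nat.cast_eq_one, Nat.card_eq_one_iff_unique]
  exact ⟨⟨fun a b => by ext1; ext1; rw [a.2, b.2]⟩, ⟨⟨0, rfl⟩⟩⟩

/-- The proportion of polynomials `p` of degree `< n` for which `gcd (p, X ^ n - 1)` has
degree `k`. -/
noncomputable def gcdDensity (k n : ℕ) : ℝ :=
  polyDensity F n fun p => gcdDegree p (X ^ n - 1) = k

/-- Over the polynomials of any degree bound `n ≥ m`, the proportion of the `p` for which
`gcd (p, X ^ m - 1)` has degree `k` is the same. -/
theorem polyDensity_gcdDegree_eq {m n : ℕ} (hm : m ≠ 0) (hmn : m ≤ n) (k : ℕ) :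
    polyDensity F n (fun p => gcdDegree p (X ^ m - 1) = k) = gcdDensity F k m := by
  have hB : (X ^ m - 1 : F[X]).Monic := monic_X_pow_sub_C 1 hm
  have hd : (X ^ m - 1 : F[X]).natDegree = m := by rw [← C_1, natDegree_X_pow_sub_C]
  have h := polyDensity_modByMonic F hB (hd.trans_le hmn)
    fun p => gcdDegree p (X ^ m - 1) = k
  rw [hd] at h
  rw [gcdDensity, ← h]
  congr 1
  ext p
  rw [gcdDegree_congr (p := p %ₘ (X ^ m - 1)) (p' := p) (A' := X ^ m - 1)]
  conv_rhs => rw [← modByMonic_add_div p (X ^ m - 1), mul_comm,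
    Ideal.span_pair_add_mul_right]

end Density

/-! ### Comparison of `X ^ n - 1` with `X ^ gcd (n, N) - 1` -/

section Comparison

variable {F : Type*} [Field F]

theorem X_pow_sub_one_dvd_of_dvd {m n : ℕ} (h : m ∣ n) : (X ^ m - 1 : F[X]) ∣ X ^ n - 1 := by
  obtain ⟨l, rfl⟩ := h
  exact pow_one_sub_dvd_pow_mul_sub_one X m l

/-- If `P ∣ X ^ m - 1`, then `(X ^ n - 1) / (X ^ m - 1) = ∑_{i < n / m} X ^ (m i)` is congruent to
`n / m` modulo `P`. -/
theorem char_dvd_of_irreducible_dvd {p : ℕ} [CharP F p] {m n : ℕ} (hmn : m ∣ n) (hm : m ≠ 0)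
    {P C : F[X]} (hP : Irreducible P) (hC : X ^ n - 1 = (X ^ m - 1) * C) (hPm : P ∣ X ^ m - 1)
    (hPC : P ∣ C) : p ∣ n / m := by
  obtain ⟨l, rfl⟩ := hmn
  rw [Nat.mul_div_cancel_left _ (Nat.pos_of_ne_zero hm)]
  have hne : (X ^ m - 1 : F[X]) ≠ 0 := (monic_X_pow_sub_C 1 hm).ne_zero
  have hC' : C = ∑ i ∈ Finset.range l, (X ^ m) ^ i := by
    apply mul_left_cancel₀ hne
    rw [← hC, mul_geom_sum, pow_mul]
  have hX : Ideal.Quotient.mk (Ideal.span {P}) (X ^ m) = 1 := by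
    rw [← sub_eq_zero, ← map_one (Ideal.Quotient.mk (Ideal.span {P})), ← map_sub,
      Ideal.Quotient.eq_zero_iff_dvd]
    exact hPm
  have h0 := (Ideal.Quotient.eq_zero_iff_dvd P C).2 hPC
  rw [hC', map_sum] at h0
  simp only [map_pow] at h0 hX
  simp only [hX, one_pow, Finset.sum_const, Finset.card_range, nsmul_eq_mul, mul_one] at h0
  rw [← map_natCast (Ideal.Quotient.mk (Ideal.span {P})), Ideal.Quotient.eq_zero_iff_dvd] at h0
  rw [← CharP.cast_eq_zero_iff F p]
  by_contra hl
  refine hP.not_isUnit (isUnit_of_dvd_unit h0 ?_)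
  rw [← C_eq_natCast]
  exact isUnit_C.2 (isUnit_iff_ne_zero.2 hl)

variable [Finite F]

/-- A root of an irreducible polynomial `P` of degree `d` lies in a field with `q ^ d` elements, so
its order divides `q ^ d - 1`. -/
theorem irreducible_dvd_X_pow_gcd_sub_one {P : F[X]} (hP : Irreducible P) {n : ℕ} (hn : n ≠ 0)
    (h : P ∣ X ^ n - 1) : P ∣ X ^ n.gcd (Nat.card F ^ P.natDegree - 1) - 1 := by
  have key : ∀ j, P ∣ X ^ j - 1 ↔ Ideal.Quotient.mk (Ideal.span {P}) X ^ j = 1 := fun j => by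
    rw [← sub_eq_zero, ← map_pow, ← map_one (Ideal.Quotient.mk (Ideal.span {P})), ← map_sub,
      Ideal.Quotient.eq_zero_iff_dvd]
  have h1 := (key n).1 h
  have h2 : P ∣ X ^ Nat.card F ^ P.natDegree - X :=
    hP.natDegree_dvd_iff_dvd_X_pow_card_pow_sub_X.1 dvd_rfl
  rw [key]
  refine pow_gcd_eq_one.2 ⟨h1, ?_⟩
  rw [← key]
  have hq : 0 < Nat.card F ^ P.natDegree := pow_pos Nat.card_pos _
  have h3 : (X ^ Nat.card F ^ P.natDegree - X : F[X]) =
      X * (X ^ (Nat.card F ^ P.natDegree - 1) - 1) := by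
    rw [mul_sub, ← pow_succ', Nat.sub_add_cancel hq, mul_one]
  rw [h3] at h2
  refine (hP.prime.dvd_or_dvd h2).resolve_left fun hX => hP.not_isUnit ?_
  have h4 : P ∣ X ^ n := hX.trans (dvd_pow_self _ hn)
  exact isUnit_of_dvd_one (by simpa using dvd_sub h4 h)

/-- Distinct monic irreducible factors of degree `d` of `X ^ n - 1` all divide
`X ^ gcd (n, q ^ d - 1) - 1`. -/
theorem card_irreducible_factors_le {n d : ℕ} (hn : n ≠ 0) (hd : d ≠ 0) (s : Finset F[X])
    (hs : ∀ P ∈ s, Irreducible P ∧ P.Monic ∧ P.natDegree = d ∧ P ∣ X ^ n - 1) :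
    s.card ≤ n.gcd (Nat.card F ^ d - 1) := by
  set g := n.gcd (Nat.card F ^ d - 1) with hg
  have hg0 : g ≠ 0 := (Nat.gcd_pos_of_pos_left _ (Nat.pos_of_ne_zero hn)).ne'
  have hdvd : ∏ P ∈ s, P ∣ X ^ g - 1 := by
    refine Finset.prod_dvd_of_coprime (fun P hP Q hQ hPQ => ?_) fun P hP => ?_
    · obtain ⟨hPi, hPm, -, -⟩ := hs P hP
      obtain ⟨hQi, hQm, -, -⟩ := hs Q hQ
      refine (hPi.coprime_iff_not_dvd).2 fun h => hPQ ?_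
      exact eq_of_monic_of_associated hPm hQm (hPi.associated_of_dvd hQi h)
    · obtain ⟨hPi, -, rfl, hPn⟩ := hs P hP
      exact irreducible_dvd_X_pow_gcd_sub_one hPi hn hPn
  have hne : (X ^ g - 1 : F[X]) ≠ 0 := (monic_X_pow_sub_C 1 hg0).ne_zero
  have h := natDegree_le_of_dvd hdvd hne
  rw [natDegree_prod_of_monic _ _ fun P hP => (hs P hP).2.1,
    Finset.sum_congr rfl fun P hP => (hs P hP).2.2.1, Finset.sum_const, smul_eq_mul,
    ← C_1, natDegree_X_pow_sub_C] at h
  exact (Nat.le_mul_of_pos_right _ (Nat.pos_of_ne_zero hd)).trans h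

omit [Finite F] in
theorem gcdDegree_mul_of_isCoprime {p A C : F[X]} (h : IsCoprime p C) :
    gcdDegree p (A * C) = gcdDegree p A := by
  apply gcdDegree_congr
  apply le_antisymm
  · rw [Ideal.span_le, Set.insert_subset_iff, Set.singleton_subset_iff]
    exact ⟨Ideal.subset_span (by simp), Ideal.mul_mem_right _ _ (Ideal.subset_span (by simp))⟩
  · rw [Ideal.span_le, Set.insert_subset_iff, Set.singleton_subset_iff]
    refine ⟨Ideal.subset_span (by simp), ?_⟩
    obtain ⟨a, b, hab⟩ := h
    exact Ideal.mem_span_pair.2 ⟨A * a, b, by linear_combination A * hab⟩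

/-- Replacing `X ^ n - 1` by `X ^ m - 1`, where `m = gcd (n, N)`, changes the gcd only with those
polynomials that share an irreducible factor `P` with `(X ^ n - 1) / (X ^ m - 1)`. The hypotheses on
`N` force `P` to have degree `> D`. -/
theorem abs_gcdDensity_sub_gcd_le {p : ℕ} [CharP F p] (k : ℕ) {n N D : ℕ} (hn : n ≠ 0)
    (hN : ∀ d ∈ Finset.Icc 1 D, Nat.card F ^ d - 1 ∣ N) (hp : ¬ p ∣ n / n.gcd N) :
    |gcdDensity F k n - gcdDensity F k (n.gcd N)| ≤
      ∑ d ∈ Finset.Ioc D n, (n.gcd (Nat.card F ^ d - 1) : ℝ) / (Nat.card F : ℝ) ^ d := by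
  classical
  set m := n.gcd N with hmdef
  have hmn : m ∣ n := Nat.gcd_dvd_left _ _
  have hm : m ≠ 0 := (Nat.gcd_pos_of_pos_left _ (Nat.pos_of_ne_zero hn)).ne'
  have hmle : m ≤ n := Nat.le_of_dvd (Nat.pos_of_ne_zero hn) hmn
  have hne : (X ^ n - 1 : F[X]) ≠ 0 := (monic_X_pow_sub_C 1 hn).ne_zero
  have hdegn : (X ^ n - 1 : F[X]).natDegree = n := by rw [← C_1, natDegree_X_pow_sub_C]
  obtain ⟨C, hC⟩ : (X ^ m - 1 : F[X]) ∣ X ^ n - 1 := X_pow_sub_one_dvd_of_dvd hmn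
  have hC0 : C ≠ 0 := by rintro rfl; exact hne (by rw [hC, mul_zero])
  have hCn : C ∣ X ^ n - 1 := Dvd.intro_left _ hC.symm
  let s : Finset F[X] := (UniqueFactorizationMonoid.normalizedFactors C).toFinset
  have hs : ∀ P ∈ s, Irreducible P ∧ P.Monic ∧ P ∣ C := fun P hP => by
    rw [Multiset.mem_toFinset] at hP
    exact ⟨UniqueFactorizationMonoid.irreducible_of_normalized_factor P hP,
      ((Polynomial.mem_normalizedFactors_iff hC0).1 hP).2.1,
      UniqueFactorizationMonoid.dvd_of_mem_normalizedFactors hP⟩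
  have hdeg : ∀ P ∈ s, P.natDegree ∈ Finset.Ioc D n := fun P hP => by
    obtain ⟨hPi, -, hPC⟩ := hs P hP
    have hPn : P ∣ X ^ n - 1 := hPC.trans hCn
    rw [Finset.mem_Ioc]
    refine ⟨?_, (natDegree_le_of_dvd hPn hne).trans hdegn.le⟩
    by_contra! hlt
    refine hp (char_dvd_of_irreducible_dvd (F := F) hmn hm hPi hC ?_ hPC)
    refine (irreducible_dvd_X_pow_gcd_sub_one hPi hn hPn).trans
      (X_pow_sub_one_dvd_of_dvd (Nat.gcd_dvd_gcd_of_dvd_right _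
        (hN _ (Finset.mem_Icc.2 ⟨hPi.natDegree_pos, hlt⟩))))
  calc |gcdDensity F k n - gcdDensity F k m|
      = |polyDensity F n (fun p => gcdDegree p (X ^ n - 1) = k) -
          polyDensity F n (fun p => gcdDegree p (X ^ m - 1) = k)| := by
        rw [polyDensity_gcdDegree_eq F hm hmle, gcdDensity]
    _ ≤ polyDensity F n (fun p => ∃ P ∈ s, P ∣ p) := by
        refine abs_polyDensity_sub_le F fun p hp => ?_
        rw [hC, gcdDegree_mul_of_isCoprime]
        refine isCoprime_of_irreducible_dvd (fun h => hC0 h.2) fun P hP hPp hPC => hp ?_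
        obtain ⟨Q, hQ, hPQ⟩ :=
          UniqueFactorizationMonoid.exists_mem_normalizedFactors_of_dvd hC0 hP hPC
        exact ⟨Q, Multiset.mem_toFinset.2 hQ, hPQ.dvd'.trans hPp⟩
    _ ≤ ∑ P ∈ s, polyDensity F n (fun p => P ∣ p) := polyDensity_exists_mem_le F n s _
    _ = ∑ P ∈ s, ((Nat.card F : ℝ) ^ P.natDegree)⁻¹ :=
        Finset.sum_congr rfl fun P hP => polyDensity_dvd F (hs P hP).2.1
          (Finset.mem_Ioc.1 (hdeg P hP)).2
    _ = ∑ d ∈ Finset.Ioc D n, ∑ P ∈ s with P.natDegree = d,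
          ((Nat.card F : ℝ) ^ P.natDegree)⁻¹ := (Finset.sum_fiberwise_of_maps_to hdeg _).symm
    _ ≤ _ := by
        refine Finset.sum_le_sum fun d hd => ?_
        rw [Finset.sum_congr rfl fun P hP => by rw [(Finset.mem_filter.1 hP).2], Finset.sum_const,
          nsmul_eq_mul, ← div_eq_mul_inv]
        gcongr
        refine card_irreducible_factors_le hn (by grind) _ fun P hP => ?_
        obtain ⟨hPs, hPd⟩ := Finset.mem_filter.1 hP
        exact ⟨(hs P hPs).1, (hs P hPs).2.1, hPd, (hs P hPs).2.2.trans hCn⟩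

end Comparison

/-! ### Mean values of arithmetic functions -/

section Mean

/-- The mean of `f` over `1, …, T`; it is `0` for `T = 0`. -/
noncomputable def meanUpTo (f : ℕ → ℝ) (T : ℕ) : ℝ :=
  (∑ n ∈ Finset.Icc 1 T, f n) / T

/-- With `s = ∑_{n ≤ N} f n`, the difference `∑_{n ≤ T} f n - T s / N` is periodic in `T`, hence
bounded. -/
theorem Function.Periodic.tendsto_meanUpTo {f : ℕ → ℝ} {N : ℕ} (hf : Function.Periodic f N)
    (hN : N ≠ 0) : Tendsto (meanUpTo f) atTop (𝓝 ((∑ n ∈ Finset.Icc 1 N, f n) / N)) := by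
  set S : ℕ → ℝ := fun T => ∑ n ∈ Finset.Icc 1 T, f n with hS
  set c : ℝ := S N / N with hc
  have hN' : (N : ℝ) ≠ 0 := by exact_mod_cast hN
  have hsucc : ∀ T, S (T + 1) = S T + f (T + 1) := fun T =>
    Finset.sum_Icc_succ_top (Nat.le_add_left 1 T) f
  have hadd : ∀ T, S (T + N) = S T + S N := by
    intro T
    induction T with
    | zero => simp [hS]
    | succ T ih =>
      rw [Nat.add_right_comm, hsucc, ih, hsucc, Nat.add_right_comm, hf (T + 1)]
      ring
  have hper : Function.Periodic (fun T : ℕ => S T - T * c) N := fun T => by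
    simp only [hadd, Nat.cast_add, hc]
    field_simp
    ring
  obtain ⟨B, hB⟩ : ∃ B : ℝ, ∀ T : ℕ, |S T - T * c| ≤ B := by
    obtain ⟨B, hB⟩ := ((Finset.range N).image fun T : ℕ => |S T - T * c|).bddAbove
    refine ⟨B, fun T => ?_⟩
    have h := hper.map_mod_nat T
    rw [← h]
    exact hB (by
      simp only [Finset.coe_image, Set.mem_image, Finset.coe_range, Set.mem_Iio]
      exact ⟨T % N, Nat.mod_lt _ (Nat.pos_of_ne_zero hN), rfl⟩)
  rw [← tendsto_sub_nhds_zero_iff]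
  refine squeeze_zero_norm' ?_ (tendsto_const_div_atTop_nhds_zero_nat B)
  filter_upwards [eventually_gt_atTop 0] with T hT
  have hT' : (0 : ℝ) < T := by exact_mod_cast hT
  have h1 : meanUpTo f T - c = (S T - T * c) / T := by
    rw [meanUpTo]; field_simp; rfl
  change ‖meanUpTo f T - c‖ ≤ B / T
  rw [h1, norm_div, Real.norm_eq_abs, Real.norm_natCast]
  gcongr
  exact hB T

/-- A function that is approximated in mean, to any precision, by periodic functions has a mean
value. -/
theorem exists_tendsto_meanUpTo {f : ℕ → ℝ}
    (h : ∀ ε > 0, ∃ g : ℕ → ℝ, ∃ N : ℕ, N ≠ 0 ∧ Function.Periodic g N ∧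
      ∀ᶠ T in atTop, meanUpTo (fun n => |f n - g n|) T ≤ ε) :
    ∃ L, Tendsto (meanUpTo f) atTop (𝓝 L) := by
  apply cauchySeq_tendsto_of_complete
  rw [Metric.cauchySeq_iff']
  intro ε hε
  obtain ⟨g, N, hN, hg, hfg⟩ := h (ε / 4) (by positivity)
  obtain ⟨T₀, hT₀⟩ := eventually_atTop.1 hfg
  obtain ⟨T₁, hT₁⟩ := Metric.cauchySeq_iff.1 (hg.tendsto_meanUpTo hN).cauchySeq (ε / 4)
    (by positivity)
  have key : ∀ T ≥ T₀, |meanUpTo f T - meanUpTo g T| ≤ ε / 4 := fun T hT => by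
    refine le_trans ?_ (hT₀ T hT)
    simp only [meanUpTo]
    rw [← sub_div, ← Finset.sum_sub_distrib, abs_div, Nat.abs_cast]
    gcongr
    exact Finset.abs_sum_le_sum_abs _ _
  refine ⟨max T₀ T₁, fun T hT => ?_⟩
  have h1 := key T ((le_max_left _ _).trans hT)
  have h2 := key (max T₀ T₁) (le_max_left _ _)
  have h3 := hT₁ T ((le_max_right _ _).trans hT) (max T₀ T₁) (le_max_right _ _)
  rw [Real.dist_eq] at h3 ⊢
  rw [abs_le] at h1 h2
  rw [abs_lt] at h3 ⊢
  constructor <;> linarith [h1.1, h1.2, h2.1, h2.2, h3.1, h3.2]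

theorem tendsto_inv_mul_sum_floor {f : ℕ → ℝ} {L : ℝ} (h : Tendsto (meanUpTo f) atTop (𝓝 L)) :
    Tendsto (fun t : ℝ => (1 / t) * ∑ n ∈ Finset.Icc 1 ⌊t⌋₊, f n) atTop (𝓝 L) := by
  have h1 := (tendsto_nat_floor_div_atTop (R := ℝ)).mul (h.comp (tendsto_nat_floor_atTop (α := ℝ)))
  rw [one_mul] at h1
  refine h1.congr' ?_
  filter_upwards [eventually_ge_atTop 1] with t ht
  have h2 : ((⌊t⌋₊ : ℕ) : ℝ) ≠ 0 := by exact_mod_cast (Nat.floor_pos.2 ht).ne'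
  simp only [Function.comp_apply, meanUpTo]
  field_simp

end Mean

/-! ### Averages of greatest common divisors -/

section GcdSums

theorem sum_ite_dvd_le (M T : ℕ) :
    ∑ n ∈ Finset.Icc 1 T, (if M ∣ n then (1 : ℝ) else 0) ≤ T / M := by
  rw [Finset.sum_boole]
  have h : ((Finset.Icc 1 T).filter (M ∣ ·)).card = T / M := by
    rw [← Nat.Ioc_filter_dvd_card_eq_div]
    rfl
  rw [h]
  exact Nat.cast_div_le

/-- The gcd of `n` and `m` is at most the sum of their common divisors `e`, and `e` has at most
`T / e` multiples up to `T`. -/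
theorem sum_gcd_le {m : ℕ} (hm : m ≠ 0) (T : ℕ) :
    ∑ n ∈ Finset.Icc 1 T, (n.gcd m : ℝ) ≤ T * m.divisors.card := by
  calc ∑ n ∈ Finset.Icc 1 T, (n.gcd m : ℝ)
      ≤ ∑ n ∈ Finset.Icc 1 T, ∑ e ∈ m.divisors, (e : ℝ) * (if e ∣ n then 1 else 0) := by
        refine Finset.sum_le_sum fun n hn => ?_
        have h := Finset.single_le_sum (f := fun e : ℕ => (e : ℝ) * (if e ∣ n then 1 else 0))
          (fun e _ => by positivity) (Nat.mem_divisors.2 ⟨Nat.gcd_dvd_right n m, hm⟩)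
        simpa [Nat.gcd_dvd_left] using h
    _ = ∑ e ∈ m.divisors, (e : ℝ) * ∑ n ∈ Finset.Icc 1 T, (if e ∣ n then 1 else 0) := by
        rw [Finset.sum_comm]
        simp_rw [Finset.mul_sum]
    _ ≤ ∑ e ∈ m.divisors, (T : ℝ) := by
        refine Finset.sum_le_sum fun e he => ?_
        have he0 : (0 : ℝ) < e := by exact_mod_cast Nat.pos_of_mem_divisors he
        calc (e : ℝ) * _ ≤ e * (T / e) := by gcongr; exact sum_ite_dvd_le e T
          _ = T := by field_simp
    _ = T * m.divisors.card := by rw [Finset.sum_const, nsmul_eq_mul, mul_comm]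

/-- One of two complementary divisors is at most the square root. -/
theorem card_divisors_le_two_mul_sqrt (m : ℕ) : m.divisors.card ≤ 2 * m.sqrt := by
  have hsub : m.divisors ⊆ Finset.Icc 1 m.sqrt ∪ (Finset.Icc 1 m.sqrt).image (m / ·) := by
    intro e he
    have hm := Nat.ne_zero_of_mem_divisors he
    obtain ⟨f, hf⟩ := Nat.dvd_of_mem_divisors he
    have he0 := Nat.pos_of_mem_divisors he
    have hf0 : 0 < f := Nat.pos_of_ne_zero (by rintro rfl; simp at hf; exact hm hf)
    rw [Finset.mem_union, Finset.mem_image]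
    by_cases h : e ≤ m.sqrt
    · exact Or.inl (Finset.mem_Icc.2 ⟨he0, h⟩)
    · refine Or.inr ⟨f, Finset.mem_Icc.2 ⟨hf0, ?_⟩, ?_⟩
      · by_contra! h'
        have := Nat.mul_le_mul (Nat.succ_le_of_lt (not_le.1 h)) (Nat.succ_le_of_lt h')
        exact absurd (Nat.lt_succ_sqrt m) (by rw [hf] at this ⊢; simpa using this)
      · simp only [hf, Nat.mul_div_cancel _ hf0]
  calc m.divisors.card ≤ _ := Finset.card_le_card hsub
    _ ≤ _ := Finset.card_union_le _ _
    _ ≤ m.sqrt + m.sqrt := by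
        gcongr
        · simp
        · exact Finset.card_image_le.trans (by simp)
    _ = 2 * m.sqrt := by ring

theorem summable_card_divisors_div_pow {q : ℕ} (hq : 1 < q) :
    Summable fun d : ℕ => ((q ^ d - 1).divisors.card : ℝ) / (q : ℝ) ^ d := by
  have hq' : (1 : ℝ) < q := by exact_mod_cast hq
  have hr : (√(q : ℝ))⁻¹ < 1 := inv_lt_one_of_one_lt₀ (Real.lt_sqrt_of_sq_lt (by simpa using hq'))
  refine Summable.of_nonneg_of_le (fun d => by positivity) (fun d => ?_)
    ((summable_geometric_of_lt_one (by positivity) hr).mul_left 2)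
  have h1 : ((q ^ d - 1).divisors.card : ℝ) ≤ 2 * √(q : ℝ) ^ d := by
    calc ((q ^ d - 1).divisors.card : ℝ) ≤ (2 * (q ^ d - 1).sqrt : ℕ) := by
          exact_mod_cast card_divisors_le_two_mul_sqrt _
      _ ≤ 2 * √((q ^ d - 1 : ℕ) : ℝ) := by
          push_cast
          gcongr
          exact Real.nat_sqrt_le_real_sqrt
      _ ≤ 2 * √((q : ℝ) ^ d) := by
          gcongr
          exact_mod_cast Nat.sub_le _ _
      _ = 2 * √(q : ℝ) ^ d := by
          congr 1
          rw [Real.sqrt_eq_iff_mul_self_eq (by positivity) (by positivity), ← mul_pow,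
            Real.mul_self_sqrt (by positivity)]
  rw [div_le_iff₀ (by positivity)]
  refine h1.trans_eq ?_
  have hs : (√(q : ℝ)) ≠ 0 := by positivity
  have h2 : (q : ℝ) ^ d = √(q : ℝ) ^ d * √(q : ℝ) ^ d := by
    rw [← mul_pow, Real.mul_self_sqrt (by positivity)]
  rw [h2, inv_pow]
  field_simp

end GcdSums

/-! ### The mean value of the density of `k`-normal elements -/

section MeanValue

theorem pow_succ_dvd_of_dvd_div_gcd {p D n N : ℕ} (hN : p ^ D ∣ N) (h : p ∣ n / n.gcd N) :
    p ^ (D + 1) ∣ n := by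
  have key : ∀ j ≤ D + 1, p ^ j ∣ n := by
    intro j
    induction j with
    | zero => simp
    | succ j ih =>
      intro hj
      have h1 : p ^ j ∣ n.gcd N :=
        Nat.dvd_gcd (ih (by omega)) ((pow_dvd_pow p (by omega)).trans hN)
      rw [pow_succ, ← Nat.mul_div_cancel' (Nat.gcd_dvd_left n N)]
      exact mul_dvd_mul h1 h
  exact key _ le_rfl

variable (F : Type*) [Field F] [Finite F]

theorem abs_gcdDensity_sub_le {p : ℕ} [CharP F p] (k : ℕ) {n N D : ℕ} (hn : n ≠ 0)
    (hN : ∀ d ∈ Finset.Icc 1 D, Nat.card F ^ d - 1 ∣ N) (hp : p ^ D ∣ N) :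
    |gcdDensity F k n - gcdDensity F k (n.gcd N)| ≤
      (if p ^ (D + 1) ∣ n then 1 else 0) +
        ∑ d ∈ Finset.Ioc D n, (n.gcd (Nat.card F ^ d - 1) : ℝ) / (Nat.card F : ℝ) ^ d := by
  split_ifs with h
  · have h1 : |gcdDensity F k n - gcdDensity F k (n.gcd N)| ≤ 1 :=
      abs_sub_le_of_nonneg_of_le (polyDensity_nonneg F _ _) (polyDensity_le_one F _ _)
        (polyDensity_nonneg F _ _) (polyDensity_le_one F _ _)
    exact h1.trans (le_add_of_nonneg_right (Finset.sum_nonneg fun d _ => by positivity))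
  · rw [zero_add]
    exact abs_gcdDensity_sub_gcd_le (p := p) k hn hN
      fun hdiv => h (pow_succ_dvd_of_dvd_div_gcd hp hdiv)

/-- Averaging over `n` makes the error of the approximation by a periodic function small. -/
theorem meanUpTo_abs_gcdDensity_sub_le {p : ℕ} [CharP F p] (k : ℕ) {N D T : ℕ}
    (hN : ∀ d ∈ Finset.Icc 1 D, Nat.card F ^ d - 1 ∣ N) (hp : p ^ D ∣ N) (hT : T ≠ 0) :
    meanUpTo (fun n => |gcdDensity F k n - gcdDensity F k (n.gcd N)|) T ≤
      ((p : ℝ) ^ (D + 1))⁻¹ + ∑ d ∈ Finset.Ioc D T,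
        ((Nat.card F ^ d - 1).divisors.card : ℝ) / (Nat.card F : ℝ) ^ d := by
  have hT' : (0 : ℝ) < T := by exact_mod_cast Nat.pos_of_ne_zero hT
  rw [meanUpTo, div_le_iff₀ hT']
  calc ∑ n ∈ Finset.Icc 1 T, |gcdDensity F k n - gcdDensity F k (n.gcd N)|
      ≤ ∑ n ∈ Finset.Icc 1 T, ((if p ^ (D + 1) ∣ n then 1 else 0) +
          ∑ d ∈ Finset.Ioc D T, (n.gcd (Nat.card F ^ d - 1) : ℝ) / (Nat.card F : ℝ) ^ d) := by
        refine Finset.sum_le_sum fun n hn => ?_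
        obtain ⟨hn1, hnT⟩ := Finset.mem_Icc.1 hn
        refine (abs_gcdDensity_sub_le F k (by omega) hN hp).trans ?_
        gcongr
    _ = ∑ n ∈ Finset.Icc 1 T, (if p ^ (D + 1) ∣ n then (1 : ℝ) else 0) +
          ∑ d ∈ Finset.Ioc D T, (∑ n ∈ Finset.Icc 1 T, (n.gcd (Nat.card F ^ d - 1) : ℝ)) /
            (Nat.card F : ℝ) ^ d := by
        rw [Finset.sum_add_distrib, Finset.sum_comm (s := Finset.Icc 1 T)]
        simp_rw [Finset.sum_div]
    _ ≤ T / (p ^ (D + 1) : ℕ) + ∑ d ∈ Finset.Ioc D T,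
          (T * ((Nat.card F ^ d - 1).divisors.card : ℝ)) / (Nat.card F : ℝ) ^ d := by
        gcongr with d hd
        · exact sum_ite_dvd_le _ T
        · refine sum_gcd_le (Nat.sub_ne_zero_of_lt (Nat.one_lt_pow ?_ Finite.one_lt_card)) T
          have := (Finset.mem_Ioc.1 hd).1
          omega
    _ = _ := by
        rw [add_mul, Finset.sum_mul]
        push_cast
        congr 1
        · rw [div_eq_inv_mul]
        · exact Finset.sum_congr rfl fun d _ => by ring

/-- The periodic approximations are `n ↦ gcdDensity F k (gcd (n, N))` with `N` divisible by a large
power of the characteristic and by `q ^ d - 1` for all small `d ≥ 1`. -/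
theorem exists_tendsto_meanUpTo_gcdDensity (k : ℕ) :
    ∃ L, Tendsto (meanUpTo (gcdDensity F k)) atTop (𝓝 L) := by
  obtain ⟨p, hchar⟩ := CharP.exists F
  have hprime : p.Prime := CharP.char_is_prime F p
  refine exists_tendsto_meanUpTo fun ε hε => ?_
  obtain ⟨s, hs⟩ := (summable_iff_vanishing_norm.1
    (summable_card_divisors_div_pow (Finite.one_lt_card (α := F)))) (ε / 2) (by positivity)
  obtain ⟨D₀, hD₀⟩ := exists_pow_lt_of_lt_one (half_pos hε)
    (inv_lt_one_of_one_lt₀ (by exact_mod_cast hprime.one_lt : (1 : ℝ) < p))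
  set D := max D₀ (s.sup id) with hD
  set N := p ^ D * ∏ d ∈ Finset.Icc 1 D, (Nat.card F ^ d - 1) with hNdef
  have hN0 : N ≠ 0 := by
    refine mul_ne_zero (pow_ne_zero _ hprime.ne_zero) (Finset.prod_ne_zero_iff.2 fun d hd => ?_)
    refine Nat.sub_ne_zero_of_lt (Nat.one_lt_pow ?_ Finite.one_lt_card)
    have := (Finset.mem_Icc.1 hd).1
    omega
  refine ⟨fun n => gcdDensity F k (n.gcd N), N, hN0, fun n => by simp, ?_⟩
  filter_upwards [eventually_ne_atTop 0] with T hT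
  have h1 := meanUpTo_abs_gcdDensity_sub_le F (p := p) k (N := N) (D := D)
    (fun d hd => (Finset.dvd_prod_of_mem _ hd).mul_left _) (Dvd.intro _ rfl) hT
  have h2 : ((p : ℝ) ^ (D + 1))⁻¹ ≤ ε / 2 := by
    rw [← inv_pow]
    refine le_trans (pow_le_pow_of_le_one (by positivity)
      (inv_le_one_of_one_le₀ (by exact_mod_cast hprime.one_le)) ?_) hD₀.le
    exact (le_max_left _ _).trans (Nat.le_succ _)
  have hdisj : Disjoint (Finset.Ioc D T) s := by
    rw [Finset.disjoint_left]
    intro d hd hds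
    have h3 : d ≤ s.sup id := Finset.le_sup (f := id) hds
    have h4 := (Finset.mem_Ioc.1 hd).1
    have h5 : s.sup id ≤ D := le_max_right _ _
    omega
  have h3 := (le_abs_self _).trans (hs _ hdisj).le
  linarith

end MeanValue

/-! ### Independence of the field -/

section Transfer

theorem gcdDegree_map {F F' : Type*} [Field F] [Field F'] (f : F →+* F') (p A : F[X]) :
    gcdDegree (p.map f) (A.map f) = gcdDegree p A := by
  classical
  unfold gcdDegree
  rw [Polynomial.gcd_map, natDegree_map]

/-- The density depends only on the isomorphism class of the field. -/
theorem gcdDensity_congr {F F' : Type*} [Field F] [Field F'] (e : F ≃+* F') (k n : ℕ) :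
    gcdDensity F k n = gcdDensity F' k n := by
  have hdeg : ∀ p : F[X], p ∈ degreeLT F n ↔ p.map (e : F →+* F') ∈ degreeLT F' n := fun p => by
    rw [mem_degreeLT, mem_degreeLT, degree_map]
  rw [gcdDensity, gcdDensity, polyDensity, polyDensity, Nat.card_congr e.toEquiv]
  congr 2
  refine Nat.card_congr
    (((mapEquiv e).toEquiv.subtypeEquiv hdeg).subtypeEquiv fun p => ?_)
  change _ ↔ gcdDegree ((p : F[X]).map (e : F →+* F')) (X ^ n - 1) = k
  rw [← gcdDegree_map (e : F →+* F') p]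
  simp

end Transfer

theorem kNormalCount_div_eq_gcdDensity (F K : Type*) [Field F] [Finite F] [Field K] [Algebra F K]
    (k : ℕ) {n : ℕ} (hn : n ≠ 0) (h : Module.finrank F K = n) :
    (kNormalCount F K k : ℝ) / (Nat.card F : ℝ) ^ n = gcdDensity F k n := by
  have := Fintype.ofFinite F
  have : Module.Finite F K := Module.finite_of_finrank_pos (by omega)
  have : Finite K := Module.finite_of_finite F
  rw [kNormalCount_eq_card_gcdDegree, gcdDensity, polyDensity, h]

theorem theorem1 (q : ℕ) (hq : IsPrimePow q) (k : ℕ) :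
    ∃ L : ℝ, 0 ≤ L ∧
      ∀ (F : Type*) [Field F] (K : ℕ → Type*) [∀ n, Field (K n)] [∀ n, Algebra F (K n)],
        Nat.card F = q →
        (∀ n : ℕ, 1 ≤ n → Module.finrank F (K n) = n) →
        Tendsto
          (fun t : ℝ => (1 / t) *
            ∑ n ∈ Finset.Icc 1 ⌊t⌋₊, (kNormalCount F (K n) k : ℝ) / (q : ℝ) ^ n)
          atTop (𝓝 L) := by
  obtain ⟨p, r, hp, hr, rfl⟩ := (isPrimePow_nat_iff q).1 hq
  have : Fact p.Prime := ⟨hp⟩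
  obtain ⟨L, hL⟩ := exists_tendsto_meanUpTo_gcdDensity (GaloisField p r) k
  refine ⟨L, ge_of_tendsto' hL fun T => ?_, ?_⟩
  · exact div_nonneg (Finset.sum_nonneg fun n _ => polyDensity_nonneg _ _ _) (Nat.cast_nonneg _)
  intro F _ K _ _ hF hK
  have : Finite F := Nat.finite_of_card_ne_zero (by rw [hF]; exact pow_ne_zero _ hp.ne_zero)
  have := Fintype.ofFinite F
  have := Fintype.ofFinite (GaloisField p r)
  have e : F ≃+* GaloisField p r := FiniteField.ringEquivOfCardEq (by
    rw [← Nat.card_eq_fintype_card, ← Nat.card_eq_fintype_card, hF, GaloisField.card p r hr.ne'])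
  refine (tendsto_inv_mul_sum_floor hL).congr fun t => ?_
  congr 1
  refine Finset.sum_congr rfl fun n hn => ?_
  have hn1 := (Finset.mem_Icc.1 hn).1
  rw [← gcdDensity_congr e, ← kNormalCount_div_eq_gcdDensity F (K n) k (by omega) (hK n hn1), hF]
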